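/- Let $X$ be a set and let $R$ be a set of group words over $X$, that is, of finite sequences of letters $x^{\pm1}$ with $x\in X$. Let $N$ be the normal subgroup of the free group $F(X)$ generated by $R$, and let $G=\langle X\mid R\rangle=F(X)/N$. A van Kampen diagram over $\langle X\mid R\rangle$ is a finite connected graph $\Delta$ embedded in the plane (loops and multiple edges are allowed, and so is a single vertex) with oriented edges labeled by elements of $X$, an edge labeled by $x$ being read as $x^{-1}$ when it is traversed backwards, such that for each bounded face (cell) the word read on its contour, from a suitable starting point and in a suitable direction, belongs to $R$. A boundary label of $\Delta$ is a word read on the contour of the unbounded face, from any starting point and in either direction (the empty word if $\Delta$ is a single vertex). **Proposition (second half of the van Kampen lemma).** Let $\Delta$ be a van Kampen diagram over $\langle X\mid R\rangle$ with $e$ edges, and let $W$ be a boundary label of $\Delta$. Then there are $m\ge 0$ and group words $u_1,\dots,u_{m+1}$, $r_1,\dots,r_m$ over $X$ such that $W$ is equal in $F(X)$ to $$u_1r_1u_2r_2\cdots u_mr_mu_{m+1},$$ where 1. each $r_i$ is a cyclic shift of a word from $R$ or of the inverse of a word from $R$; 2. $u_1u_2\cdots u_{m+1}=1$ in $F(X)$;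 3. $\sum_{i=1}^{m+1}|u_i|\le 4e$, where $|u|$ denotes the length of the word $u$. In particular, $W$ represents an element of $N$, and $W=1$ in $G$. -/

import Mathlib

/-- The oriented edge `d` traversed backwards.  An oriented edge (dart) of a graph with edge set `E`
is a pair `(e, b)`: `(e, true)` is `e` with its own orientation, `(e, false)` is its inverse. -/
def reverseDart {E : Type*} (d : E × Bool) : E × Bool := (d.1, !d.2)

/-- A finite connected graph embedded in the oriented plane (loops and multiple edges allowed), up
to orientation preserving homeomorphism, presented as a combinatorial map of genus zero.
`V`, `E`, `F` are the sets of vertices, edges and faces; the faces are the connected components of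
the complement of the graph, and `outer` is the unbounded one. -/
structure PlaneGraph (V E F : Type*) [Fintype V] [Fintype E] [Fintype F] where
  /-- the initial vertex of a dart -/
  origin : E × Bool → V
  /-- the rotation system: the next dart, counterclockwise, around the common initial vertex -/
  rot : Equiv.Perm (E × Bool)
  /-- the face on the left of a dart -/
  face : E × Bool → F
  /-- the unbounded face -/
  outer : F
  /-- the darts issuing from one vertex form one cycle of the rotation -/
  sameCycle_rot : ∀ d d', rot.SameCycle d d' ↔ origin d = origin d'
  /-- `step` sends a dart to the next dart on the contour of the face on its left: arriving at the
  terminal vertex, one leaves along the dart that comes just before (clockwise of) the inverse of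
  the dart on which one arrived. -/
  step : Equiv.Perm (E × Bool)
  step_eq : ∀ d, step d = rot.symm (reverseDart d)
  /-- the darts with the same face on the left form one cycle of `step` -/
  sameCycle_step : ∀ d d', step.SameCycle d d' ↔ face d = face d'
  /-- every face has a dart on its contour, except that the unbounded face of a graph without edges
  has none -/
  exists_dart : ∀ f, (∃ d, face d = f) ∨ (IsEmpty E ∧ f = outer)
  /-- the graph is connected -/
  connected : ∀ v w,
    Relation.ReflTransGen (fun a b => ∃ d, origin d = a ∧ origin (reverseDart d) = b) v w
  /-- Euler's formula, that is, the surface carrying the map is the sphere -/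
  euler : Fintype.card V + Fintype.card F = Fintype.card E + 2

namespace PlaneGraph

variable {V E F : Type*} [Fintype V] [Fintype E] [Fintype F]

/-- The contour of the face on the left of `d`, started with `d`: the closed path
`d, step d, step (step d), …` of darts, traversed once. -/
noncomputable def contour (G : PlaneGraph V E F) (d : E × Bool) : List (E × Bool) :=
  List.iterate G.step d (Function.minimalPeriod G.step d)

/-- If the edges of the graph are labeled by elements of `X`, then the word read on the contour
of the face on the left of `d`, started with `d`.  The dart `(e, true)` reads the letter `label e`
and the dart `(e, false)` its inverse.  Group words over `X` are lists in `X × Bool`, the letter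
`(x, true)` being `x` and `(x, false)` being the inverse of `x`, as in `FreeGroup.mk`. -/
noncomputable def contourWord {X : Type*} (G : PlaneGraph V E F) (label : E → X)
    (d : E × Bool) : List (X × Bool) :=
  (G.contour d).map fun c => (label c.1, c.2)

/-- The word `w` is read on the contour of the face `f`, started at some vertex occurrence on the
contour and traversed in one of the two directions. -/
def ReadsAround {X : Type*} (G : PlaneGraph V E F) (label : E → X) (f : F)
    (w : List (X × Bool)) : Prop :=
  ∃ d, G.face d = f ∧
    (w = G.contourWord label d ∨ w = FreeGroup.invRev (G.contourWord label d))

end PlaneGraph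

/-- A van Kampen diagram over the presentation `⟨X | R⟩`: a finite connected plane graph with edges
labeled by elements of `X` such that the contour of every cell (bounded face) is labeled by a word
from `R` or by the inverse of a word from `R`. -/
structure VanKampenDiagram {X : Type*} (R : Set (List (X × Bool)))
    (V E F : Type*) [Fintype V] [Fintype E] [Fintype F] extends PlaneGraph V E F where
  label : E → X
  cell_label : ∀ f, f ≠ outer → ∃ r ∈ R, toPlaneGraph.ReadsAround label f r

/-- `W` is a boundary label of the diagram: it is read on the contour of the unbounded face.  The
boundary label of the diagram that consists of a single vertex is the empty word. -/
def VanKampenDiagram.IsBoundaryLabel {X : Type*} {R : Set (List (X × Bool))}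
    {V E F : Type*} [Fintype V] [Fintype E] [Fintype F]
    (Δ : VanKampenDiagram R V E F) (W : List (X × Bool)) : Prop :=
  Δ.ReadsAround Δ.label Δ.outer W ∨ (IsEmpty E ∧ W = [])

/-! Read `W` along the contour of the unbounded face, and let `S` at first consist of that face
alone. When the walk meets a dart `d` with a cell outside `S` on its other side, delete the edge of
`d` and detour along the rest `c` of the contour of that cell. Since d = (d c⁻¹) c in the free
group, this inserts one relator d c⁻¹, up to cyclic shift and inversion, and merges the cell into
`S` (`IsMergedContour.merge`, `exists_insertsInto_aux`).

When no such dart is left, `S` is closed under adjacency of faces, hence contains all of them. One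
edge was deleted per cell, so by Euler's formula |V| - 1 edges remain; they still connect all
vertices and form a tree. A closed walk in a tree reads 1 in the free group (`exists_potential`,
`IsMergedContour.mk_dartWord_eq_one`). The word of this last walk is u₁⋯uₘ₊₁. No dart occurs in it
twice, so its length is at most 2e, which is better than the required 4e. -/

/-! ### Words with relators inserted -/

/-- `InsertsInto A p g`: the element `g` of the free group is obtained from the word `p` by
inserting words from `A` between its letters. -/
inductive InsertsInto {X : Type*} (A : Set (List (X × Bool))) :
    List (X × Bool) → FreeGroup X → Prop
  | nil : InsertsInto A [] 1
  | letter (a : X × Bool) {p : List (X × Bool)} {g : FreeGroup X} :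
      InsertsInto A p g → InsertsInto A (a :: p) (FreeGroup.mk [a] * g)
  | insert {r : List (X × Bool)} (hr : r ∈ A) {p : List (X × Bool)} {g : FreeGroup X} :
      InsertsInto A p g → InsertsInto A p (FreeGroup.mk r * g)

namespace InsertsInto

variable {X : Type*} {A : Set (List (X × Bool))}

theorem append {p q : List (X × Bool)} {g h : FreeGroup X} (hp : InsertsInto A p g)
    (hq : InsertsInto A q h) : InsertsInto A (p ++ q) (g * h) := by
  induction hp with
  | nil => simpa using hq
  | letter a _ ih => rw [mul_assoc]; exact .letter a ih
  | insert hr _ ih => rw [mul_assoc]; exact .insert hr ih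

theorem inv (hA : ∀ r ∈ A, FreeGroup.invRev r ∈ A) {p : List (X × Bool)} {g : FreeGroup X}
    (hp : InsertsInto A p g) : InsertsInto A (FreeGroup.invRev p) g⁻¹ := by
  induction hp with
  | nil => simpa using InsertsInto.nil
  | @letter a p g _ ih =>
    have h := ih.append (.letter (A := A) (a.1, !a.2) .nil)
    have e : FreeGroup.invRev (a :: p) = FreeGroup.invRev p ++ [(a.1, !a.2)] := by
      simp [FreeGroup.invRev]
    rw [e, mul_inv_rev, FreeGroup.inv_mk]
    simpa [FreeGroup.invRev] using h
  | insert hr _ ih =>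
    have h := ih.append (.insert (hA _ hr) .nil)
    rw [mul_inv_rev, FreeGroup.inv_mk]
    simpa using h

theorem map_eq {H : Type*} [Group H] (f : FreeGroup X →* H)
    (hA : ∀ r ∈ A, f (FreeGroup.mk r) = 1) {p : List (X × Bool)} {g : FreeGroup X}
    (hp : InsertsInto A p g) : f g = f (FreeGroup.mk p) := by
  induction hp with
  | nil => rfl
  | @letter a p g _ ih =>
    rw [map_mul, ih, ← map_mul, FreeGroup.mul_mk]; rfl
  | insert hr _ ih => rw [map_mul, hA _ hr, one_mul, ih]

/-- Letters are grouped into blocks: an insertion opens a new block with empty prefix, a letter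
lengthens the prefix of the first block, and `t` collects the letters after the last insertion. -/
theorem exists_list {p : List (X × Bool)} {g : FreeGroup X} (hp : InsertsInto A p g) :
    ∃ (l : List (List (X × Bool) × List (X × Bool))) (t : List (X × Bool)),
      g = FreeGroup.mk ((l.map fun x => x.1 ++ x.2).flatten ++ t) ∧
      p = (l.map Prod.fst).flatten ++ t ∧ ∀ x ∈ l, x.2 ∈ A := by
  induction hp with
  | nil => exact ⟨[], [], rfl, rfl, by simp⟩
  | letter a _ ih =>
    obtain ⟨l, t, rfl, rfl, h⟩ := ih
    cases l with
    | nil => exact ⟨[], a :: t, by simp [FreeGroup.mul_mk], by simp, by simp⟩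
    | cons x l =>
      refine ⟨(a :: x.1, x.2) :: l, t, by simp [FreeGroup.mul_mk], by simp, ?_⟩
      simpa using h
  | @insert r hr _ _ _ ih =>
    obtain ⟨l, t, rfl, rfl, h⟩ := ih
    exact ⟨([], r) :: l, t, by simp [FreeGroup.mul_mk], by simp, by simpa using ⟨hr, by simpa using h⟩⟩

theorem exists_fin {p : List (X × Bool)} {g : FreeGroup X} (hp : InsertsInto A p g) :
    ∃ (m : ℕ) (u : Fin (m + 1) → List (X × Bool)) (r : Fin m → List (X × Bool)),
      g = FreeGroup.mk
        ((List.ofFn fun i : Fin m => u i.castSucc ++ r i).flatten ++ u (Fin.last m)) ∧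
      (∀ i, r i ∈ A) ∧ (List.ofFn u).flatten = p := by
  obtain ⟨l, t, rfl, rfl, h⟩ := hp.exists_list
  have ofFn_map {β : Type _} (f : List (X × Bool) × List (X × Bool) → β) :
      List.ofFn (fun i => f (l.get i)) = l.map f := by
    conv_rhs => rw [← List.ofFn_get l, List.map_ofFn]
    rfl
  refine ⟨l.length, Fin.snoc (α := fun _ => List (X × Bool)) (fun i => (l.get i).1) t,
    fun i => (l.get i).2, ?_, fun i => h _ (List.get_mem l i), ?_⟩
  · simp only [Fin.snoc_castSucc, Fin.snoc_last]
    rw [ofFn_map fun x => x.1 ++ x.2]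
  · rw [List.ofFn_succ']
    simp only [Fin.snoc_castSucc, Fin.snoc_last]
    rw [ofFn_map Prod.fst]
    simp

end InsertsInto

/-! ### Cyclic shifts of relators -/

/-- The cyclic shifts of the words from `R` and of their inverses. -/
def cyclicShifts {X : Type*} (R : Set (List (X × Bool))) : Set (List (X × Bool)) :=
  {r | ∃ s ∈ R, List.IsRotated r s ∨ List.IsRotated r (FreeGroup.invRev s)}

theorem isRotated_invRev {X : Type*} {a b : List (X × Bool)} (h : List.IsRotated a b) :
    List.IsRotated (FreeGroup.invRev a) (FreeGroup.invRev b) :=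
  (h.map _).reverse

theorem cyclicShifts_of_isRotated {X : Type*} {R : Set (List (X × Bool))}
    {a b : List (X × Bool)} (h : List.IsRotated a b) (hb : b ∈ cyclicShifts R) :
    a ∈ cyclicShifts R := by
  obtain ⟨s, hs, h' | h'⟩ := hb
  · exact ⟨s, hs, .inl (h.trans h')⟩
  · exact ⟨s, hs, .inr (h.trans h')⟩

theorem invRev_mem_cyclicShifts {X : Type*} {R : Set (List (X × Bool))}
    {a : List (X × Bool)} (ha : a ∈ cyclicShifts R) : FreeGroup.invRev a ∈ cyclicShifts R := by
  obtain ⟨s, hs, h | h⟩ := ha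
  · exact ⟨s, hs, .inr (isRotated_invRev h)⟩
  · exact ⟨s, hs, .inl (by simpa using isRotated_invRev h)⟩

theorem isConj_mk_of_isRotated {X : Type*} {a b : List (X × Bool)} (h : List.IsRotated a b) :
    IsConj (FreeGroup.mk b) (FreeGroup.mk a) := by
  obtain ⟨n, rfl⟩ := h
  rw [List.rotate_eq_drop_append_take_mod, ← FreeGroup.mul_mk, isConj_iff]
  refine ⟨FreeGroup.mk (a.take (n % a.length)), ?_⟩
  rw [mul_assoc, mul_inv_cancel_right, FreeGroup.mul_mk, List.take_append_drop]

theorem mk_mem_normalClosure_of_mem_cyclicShifts {X : Type*} {R : Set (List (X × Bool))}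
    {r : List (X × Bool)} (hr : r ∈ cyclicShifts R) :
    FreeGroup.mk r ∈ Subgroup.normalClosure (FreeGroup.mk '' R) := by
  have conj {a b : FreeGroup X} (h : IsConj a b)
      (ha : a ∈ Subgroup.normalClosure (FreeGroup.mk '' R)) :
      b ∈ Subgroup.normalClosure (FreeGroup.mk '' R) := by
    obtain ⟨c, rfl⟩ := isConj_iff.1 h
    exact Subgroup.normalClosure_normal.conj_mem _ ha c
  obtain ⟨s, hs, h⟩ := hr
  have hs' : FreeGroup.mk s ∈ Subgroup.normalClosure (FreeGroup.mk '' R) :=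
    Subgroup.subset_normalClosure ⟨s, hs, rfl⟩
  obtain h | h := h
  · exact conj (isConj_mk_of_isRotated h) hs'
  · exact conj (isConj_mk_of_isRotated h) (by rw [← FreeGroup.inv_mk]; exact inv_mem hs')

/-! ### Walks and potentials -/

theorem reverseDart_reverseDart {E : Type*} (d : E × Bool) :
    reverseDart (reverseDart d) = d := by
  simp [reverseDart]

theorem eq_or_eq_reverseDart {E : Type*} {d d' : E × Bool} (h : d'.1 = d.1) :
    d' = d ∨ d' = reverseDart d := by
  obtain ⟨e, b⟩ := d
  obtain ⟨e', b'⟩ := d'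
  obtain rfl : e' = e := h
  cases b <;> cases b' <;> simp [reverseDart]

/-- The darts in the list form a walk from `v` to `w`, where `o` is the initial vertex of a dart. -/
def IsDartWalk {V E : Type*} (o : E × Bool → V) : V → List (E × Bool) → V → Prop
  | v, [], w => v = w
  | v, d :: L, w => o d = v ∧ IsDartWalk o (o (reverseDart d)) L w

section Walk

variable {V E : Type*} {o : E × Bool → V}

theorem isDartWalk_append {L M : List (E × Bool)} {v w : V} :
    IsDartWalk o v (L ++ M) w ↔ ∃ x, IsDartWalk o v L x ∧ IsDartWalk o x M w := by
  induction L generalizing v with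
  | nil => simp [IsDartWalk]
  | cons d L ih => simp [IsDartWalk, ih, and_assoc]

theorem IsDartWalk.exists_exit {L : List (E × Bool)} {v w : V} (h : IsDartWalk o v L w)
    {U : Set V} (hv : v ∈ U) (hw : w ∉ U) :
    ∃ d ∈ L, o d ∈ U ∧ o (reverseDart d) ∉ U := by
  induction L generalizing v with
  | nil => exact absurd (h ▸ hv) hw
  | cons d L ih =>
    obtain ⟨rfl, h⟩ := h
    by_cases hd : o (reverseDart d) ∈ U
    · obtain ⟨d', hd', h'⟩ := ih h hd
      exact ⟨d', by simp [hd'], h'⟩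
    · exact ⟨d, by simp, hv, hd⟩

/-- The walk `L` started at `v₀` passes through `v`. -/
def WalkVisits (o : E × Bool → V) (v₀ : V) (L : List (E × Bool)) (v : V) : Prop :=
  ∃ A B, L = A ++ B ∧ IsDartWalk o v₀ A v

/-- A prefix of the walk either stops before `d` and is untouched, or contains `d`, and then `c` is
substituted for `d` inside it; the endpoint is the same. -/
theorem WalkVisits.replace {v₀ v : V} {P c Q : List (E × Bool)} {d : E × Bool}
    (h : WalkVisits o v₀ (P ++ d :: Q) v) (hc : IsDartWalk o (o d) c (o (reverseDart d))) :
    WalkVisits o v₀ (P ++ (c ++ Q)) v := by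
  obtain ⟨A, B, h, hA⟩ := h
  obtain ⟨a, rfl, h'⟩ | ⟨b, rfl, rfl⟩ := List.append_eq_append_iff.1 h
  · cases a with
    | nil => exact ⟨P, _, rfl, by simpa using hA⟩
    | cons d' a =>
      rw [List.cons_append, List.cons.injEq] at h'
      obtain ⟨rfl, rfl⟩ := h'
      obtain ⟨x, hP, rfl, ha⟩ := isDartWalk_append.1 hA
      exact ⟨P ++ (c ++ a), B, by simp,
        isDartWalk_append.2 ⟨_, hP, isDartWalk_append.2 ⟨_, hc, ha⟩⟩⟩
  · exact ⟨A, b ++ (c ++ Q), by simp, hA⟩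

end Walk

/-- The word read along a list of darts. -/
def dartWord {X E : Type*} (label : E → X) (L : List (E × Bool)) : List (X × Bool) :=
  L.map fun c => (label c.1, c.2)

/-- In a connected graph with one more vertex than edges, labels in a group have a potential. -/
theorem exists_potential {V E H : Type*} [Fintype V] [Group H] {o : E × Bool → V}
    (K : Finset E) (hK : K.card + 1 = Fintype.card V) (v₀ : V)
    (hexit : ∀ U : Finset V, v₀ ∈ U → U ≠ Finset.univ →
      ∃ d : E × Bool, d.1 ∈ K ∧ o d ∈ U ∧ o (reverseDart d) ∉ U)
    (lab : E × Bool → H) (hlab : ∀ d, lab (reverseDart d) = (lab d)⁻¹) :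
    ∃ φ : V → H, ∀ d : E × Bool, d.1 ∈ K → φ (o (reverseDart d)) = φ (o d) * lab d := by
  classical
  -- A tree `T` is grown edge by edge on the vertex set `U`; each exit edge brings a new vertex,
  -- where the potential can be prescribed freely. At n = |K| the tree exhausts `K`.
  have key : ∀ n, n ≤ K.card → ∃ (U : Finset V) (T : Finset E) (φ : V → H),
      v₀ ∈ U ∧ U.card = n + 1 ∧ T ⊆ K ∧ T.card = n ∧ ∀ d : E × Bool, d.1 ∈ T →
        o d ∈ U ∧ φ (o (reverseDart d)) = φ (o d) * lab d := by
    intro n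
    induction n with
    | zero => exact fun _ => ⟨{v₀}, ∅, fun _ => 1, by simp⟩
    | succ n ih =>
      intro hn
      obtain ⟨U, T, φ, hv, hU, hTK, hT, hφ⟩ := ih (by omega)
      -- `U` has n + 1 ≤ |K| < |V| vertices, so it can be left.
      obtain ⟨d, hdK, hdU, hd⟩ := hexit U hv (by rintro rfl; simp at hU; omega)
      have hdT : d.1 ∉ T := fun h => hd (hφ (reverseDart d) h).1
      refine ⟨insert (o (reverseDart d)) U, insert d.1 T,
        Function.update φ (o (reverseDart d)) (φ (o d) * lab d), by simp [hv], by simp [hd, hU],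
        by simp [Finset.insert_subset_iff, hdK, hTK], by simp [hdT, hT], fun d' hd' => ?_⟩
      have hne : o d ≠ o (reverseDart d) := fun h => hd (h ▸ hdU)
      rcases Finset.mem_insert.1 hd' with h | h
      · obtain rfl | rfl := eq_or_eq_reverseDart h
        · simp [hdU, hne]
        · simp [reverseDart_reverseDart, hne, hlab]
      · have h1 := hφ d' h
        have h2 := (hφ (reverseDart d') h).1
        have n1 : o d' ≠ o (reverseDart d) := fun h => hd (h ▸ h1.1)
        have n2 : o (reverseDart d') ≠ o (reverseDart d) := fun h => hd (h ▸ h2)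
        simp [h1, n1, n2]
  obtain ⟨U, T, φ, -, -, hTK, hT, hφ⟩ := key _ le_rfl
  obtain rfl := Finset.eq_of_subset_of_card_le hTK hT.ge
  exact ⟨φ, fun d hd => (hφ d hd).2⟩

/-- The potential differences telescope; for a closed walk the word must be trivial. -/
theorem mk_dartWord_of_potential {V E X : Type*} {o : E × Bool → V} {label : E → X}
    {φ : V → FreeGroup X} {L : List (E × Bool)} {v w : V} (hL : IsDartWalk o v L w)
    (hφ : ∀ d ∈ L, φ (o (reverseDart d)) = φ (o d) * FreeGroup.mk [(label d.1, d.2)]) :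
    φ w = φ v * FreeGroup.mk (dartWord label L) := by
  induction L generalizing v with
  | nil => rw [← (show v = w from hL)]; exact (mul_one _).symm
  | cons d L ih =>
    obtain ⟨rfl, h⟩ := hL
    rw [ih h fun d hd => hφ d (by simp [hd]), hφ d (by simp), mul_assoc, FreeGroup.mul_mk]
    rfl

/-! ### Contours of faces and the dual graph -/

namespace PlaneGraph

variable {V E F : Type*} [Fintype V] [Fintype E] [Fintype F] (G : PlaneGraph V E F)

theorem origin_step (d : E × Bool) : G.origin (G.step d) = G.origin (reverseDart d) := by
  rw [← G.sameCycle_rot, G.step_eq]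
  exact (Equiv.Perm.sameCycle_symm_apply_left).2 (Equiv.Perm.SameCycle.refl _ _)

theorem face_step (d : E × Bool) : G.face (G.step d) = G.face d := by
  rw [← G.sameCycle_step]
  exact (Equiv.Perm.sameCycle_apply_left).2 (Equiv.Perm.SameCycle.refl _ _)

theorem isDartWalk_iterate (d : E × Bool) (n : ℕ) :
    IsDartWalk G.origin (G.origin d) (List.iterate G.step d n) (G.origin (G.step^[n] d)) := by
  induction n generalizing d with
  | zero => rfl
  | succ n ih =>
    refine ⟨rfl, ?_⟩
    rw [← G.origin_step]
    exact ih _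

theorem isPeriodicPt_step (d : E × Bool) : d ∈ Function.periodicPts G.step :=
  G.step.injective.mem_periodicPts d

theorem isDartWalk_contour (d : E × Bool) :
    IsDartWalk G.origin (G.origin d) (G.contour d) (G.origin d) := by
  have h := G.isDartWalk_iterate d (Function.minimalPeriod G.step d)
  rwa [Function.iterate_minimalPeriod] at h

/-- Gives access to the library on periodic orbits, for membership, absence of repetitions and
change of starting point. -/
theorem contour_coe (d : E × Bool) : (G.contour d : Cycle (E × Bool)) =
    Function.periodicOrbit G.step d := by
  rw [contour, ← List.range_map_iterate, Function.periodicOrbit]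

theorem nodup_contour (d : E × Bool) : (G.contour d).Nodup := by
  rw [← Cycle.nodup_coe_iff, contour_coe]
  exact Function.nodup_periodicOrbit

theorem exists_iterate_of_face_eq {d d' : E × Bool} (h : G.face d = G.face d') :
    ∃ n : ℕ, G.step^[n] d = d' := by
  obtain ⟨n, -, hn⟩ := ((G.sameCycle_step d d').2 h).exists_pow_eq'
  exact ⟨n, by rwa [Equiv.Perm.iterate_eq_pow]⟩

theorem mem_contour {d d' : E × Bool} : d' ∈ G.contour d ↔ G.face d' = G.face d := by
  rw [← Cycle.mem_coe_iff, contour_coe,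
    Function.mem_periodicOrbit_iff (G.isPeriodicPt_step d)]
  constructor
  · rintro ⟨n, rfl⟩
    induction n with
    | zero => rfl
    | succ n ih => rw [Function.iterate_succ_apply', face_step, ih]
  · exact fun h => G.exists_iterate_of_face_eq h.symm

theorem isRotated_contour {d d' : E × Bool} (h : G.face d = G.face d') :
    List.IsRotated (G.contour d) (G.contour d') := by
  obtain ⟨n, rfl⟩ := G.exists_iterate_of_face_eq h
  rw [← Cycle.coe_eq_coe, contour_coe, contour_coe,
    Function.periodicOrbit_apply_iterate_eq (G.isPeriodicPt_step d)]

theorem exists_contour_eq_cons (d : E × Bool) : ∃ c, G.contour d = d :: c := by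
  have h := Function.minimalPeriod_pos_of_mem_periodicPts (G.isPeriodicPt_step d)
  obtain ⟨n, hn⟩ := Nat.exists_eq_succ_of_ne_zero h.ne'
  exact ⟨List.iterate G.step (G.step d) n, by rw [contour, hn]; rfl⟩

/-- The dual graph is connected. -/
theorem mem_of_dual_closed (S : Set F) (d₀ : E × Bool) (h₀ : G.face d₀ ∈ S)
    (hS : ∀ d, G.face d ∈ S → G.face (reverseDart d) ∈ S) (d : E × Bool) : G.face d ∈ S := by
  -- The inverse of `rot d` is followed by `d` on a contour, so the faces of `rot d` and `d` lie on
  -- the two sides of one edge. Membership in `S` thus spreads around a vertex, and then along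
  -- paths.
  have hrot : ∀ d, G.face (G.rot d) ∈ S ↔ G.face d ∈ S := by
    intro d
    have h : G.step (reverseDart (G.rot d)) = d := by
      rw [G.step_eq, reverseDart_reverseDart, Equiv.symm_apply_apply]
    have h' : G.face (reverseDart (G.rot d)) = G.face d := by rw [← G.face_step, h]
    rw [← h']
    refine ⟨hS _, fun h => ?_⟩
    simpa [reverseDart_reverseDart] using hS _ h
  have hcyc : ∀ d d', G.origin d = G.origin d' → G.face d ∈ S → G.face d' ∈ S := by
    intro d d' h hd
    obtain ⟨n, -, hn⟩ := ((G.sameCycle_rot d d').2 h).exists_pow_eq'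
    rw [← hn]
    clear hn
    induction n with
    | zero => exact hd
    | succ n ih => rw [pow_succ', Equiv.Perm.mul_apply, hrot]; exact ih
  have hv : ∀ w, Relation.ReflTransGen
      (fun a b => ∃ d, G.origin d = a ∧ G.origin (reverseDart d) = b) (G.origin d₀) w →
      ∃ d, G.origin d = w ∧ G.face d ∈ S := by
    intro w hw
    induction hw with
    | refl => exact ⟨d₀, rfl, h₀⟩
    | tail _ h ih =>
      obtain ⟨d, rfl, rfl⟩ := h
      obtain ⟨d', h', hd'⟩ := ih
      exact ⟨reverseDart d, rfl, hS _ (hcyc _ _ h' hd')⟩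
  obtain ⟨d', h', hd'⟩ := hv _ (G.connected (G.origin d₀) (G.origin d))
  exact hcyc _ _ h' hd'

theorem exists_origin_eq (d₀ : E × Bool) (v : V) : ∃ d, G.origin d = v := by
  obtain h | ⟨_, _, d, rfl, rfl⟩ := (G.connected (G.origin d₀) v).cases_tail
  · exact ⟨d₀, h.symm⟩
  · exact ⟨_, rfl⟩

/-! ### Merging faces -/

/-- The closed walk `L` at `v₀` goes around the union of the faces from `S`, after these have been
merged into one by the removal of the edges from `D`. -/
structure IsMergedContour (v₀ : V) (S : Finset F) (D : Finset E) (L : List (E × Bool)) :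
    Prop where
  walk : IsDartWalk G.origin v₀ L v₀
  nodup : L.Nodup
  mem_iff : ∀ d, d ∈ L ↔ G.face d ∈ S ∧ d.1 ∉ D
  face_mem : ∀ d : E × Bool, d.1 ∈ D → G.face d ∈ S
  visits : ∀ d, G.face d ∈ S → WalkVisits G.origin v₀ L (G.origin d)
  card : D.card + 1 = S.card

variable {G}

theorem isMergedContour_contour (d : E × Bool) :
    G.IsMergedContour (G.origin d) {G.face d} ∅ (G.contour d) where
  walk := G.isDartWalk_contour d
  nodup := G.nodup_contour d
  mem_iff d' := by simp [mem_contour]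
  face_mem := by simp
  visits d' h := by
    obtain ⟨A, B, h⟩ := List.append_of_mem (G.mem_contour.2 (Finset.mem_singleton.1 h))
    have hw := h ▸ G.isDartWalk_contour d
    obtain ⟨x, hA, rfl, -⟩ := isDartWalk_append.1 hw
    exact ⟨A, _, h, hA⟩
  card := by simp

theorem IsMergedContour.merge [DecidableEq E] [DecidableEq F] {v₀ : V} {S : Finset F}
    {D : Finset E} {P Q c : List (E × Bool)} {d : E × Bool}
    (h : G.IsMergedContour v₀ S D (P ++ d :: Q)) (hd : G.face (reverseDart d) ∉ S)
    (hc : G.contour (reverseDart d) = reverseDart d :: c) :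
    G.IsMergedContour v₀ (insert (G.face (reverseDart d)) S) (insert d.1 D) (P ++ (c ++ Q)) := by
  obtain ⟨x, hP, rfl, hQ⟩ := isDartWalk_append.1 h.walk
  have hcw : IsDartWalk G.origin (G.origin d) c (G.origin (reverseDart d)) := by
    have := hc ▸ G.isDartWalk_contour (reverseDart d)
    have := this.2
    rwa [reverseDart_reverseDart] at this
  have hcn := hc ▸ G.nodup_contour (reverseDart d)
  have hcm : ∀ d', d' ∈ reverseDart d :: c ↔ G.face d' = G.face (reverseDart d) := by
    intro d'; rw [← hc, mem_contour]
  have hdS := ((h.mem_iff d).1 (by simp))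
  have hLn := h.nodup
  refine ⟨isDartWalk_append.2 ⟨_, hP, isDartWalk_append.2 ⟨_, hcw, hQ⟩⟩, ?_, ?_, ?_, ?_, ?_⟩
  · have hLd : ∀ d' ∈ P ++ d :: Q, d' ∉ c := by
      intro d' h1 h2
      have := (h.mem_iff d').1 h1
      rw [(hcm d').1 (by simp [h2])] at this
      exact hd this.1
    rw [List.nodup_append] at hLn ⊢
    obtain ⟨h1, h2, h3⟩ := hLn
    rw [List.nodup_append]
    refine ⟨h1, ⟨(List.nodup_cons.1 hcn).2, (List.nodup_cons.1 h2).2, ?_⟩, ?_⟩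
    · rintro a ha b hb rfl
      exact hLd a (by simp [hb]) ha
    · rintro a ha b hb rfl
      rcases List.mem_append.1 hb with hb | hb
      · exact hLd a (by simp [ha]) hb
      · exact h3 a ha a (by simp [hb]) rfl
  · intro d'
    have h1 := h.mem_iff d'
    have h2 := hcm d'
    have h3 : d' = d → d' ∉ P ∧ d' ∉ Q := by
      rintro rfl
      rw [List.nodup_append] at hLn
      exact ⟨fun h => hLn.2.2 _ h d' (by simp) rfl, (List.nodup_cons.1 hLn.2.1).1⟩
    have h4 := (List.nodup_cons.1 hcn).1
    by_cases he : d'.1 = d.1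
    -- Neither dart of the deleted edge survives: `d` occurred only once and its face is not the new
    -- one, while its inverse opens the contour of the cell and does not recur there.
    · simp only [he, Finset.mem_insert, true_or, not_true, and_false, iff_false]
      obtain rfl | rfl := eq_or_eq_reverseDart he
      · have : d' ∉ c := fun hm => hd (by rw [← h2.1 (by simp [hm])]; exact hdS.1)
        simp [this, h3 rfl]
      · have : reverseDart d ∉ P ++ d :: Q := fun hm => hd (h1.1 hm).1
        simp only [List.mem_append, List.mem_cons, not_or] at this ⊢
        exact ⟨this.1, h4, this.2.2⟩
    · have n1 : d' ≠ d := fun h => he (h ▸ rfl)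
      have n2 : d' ≠ reverseDart d := fun h => he (h ▸ rfl)
      -- Edges deleted earlier have faces of `S` on both sides, so none lies on the contour of the
      -- new cell.
      have n3 : G.face d' = G.face (reverseDart d) → d'.1 ∉ D := fun hf hD =>
        hd (hf ▸ h.face_mem d' hD)
      simp only [List.mem_append, List.mem_cons, n1, n2, false_or, Finset.mem_insert, he] at *
      tauto
  · intro d' hd'
    rw [Finset.mem_insert] at hd' ⊢
    rcases hd' with he | hD
    · obtain rfl | rfl := eq_or_eq_reverseDart he
      · exact .inr hdS.1
      · exact .inl rfl
    · exact .inr (h.face_mem d' hD)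
  · intro d' hd'
    rcases Finset.mem_insert.1 hd' with hf | hS
    · rcases List.mem_cons.1 ((hcm d').2 hf) with rfl | hm
      · exact ⟨P ++ c, Q, by simp, isDartWalk_append.2 ⟨_, hP, hcw⟩⟩
      · obtain ⟨A, B, rfl⟩ := List.append_of_mem hm
        obtain ⟨x, hA, rfl, -⟩ := isDartWalk_append.1 hcw
        exact ⟨P ++ A, d' :: B ++ Q, by simp, isDartWalk_append.2 ⟨_, hP, hA⟩⟩
    · exact (h.visits d' hS).replace hcw
  · rw [Finset.card_insert_of_notMem hdS.2, Finset.card_insert_of_notMem hd, h.card]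

/-- When all faces have been merged, what remains of the graph is a tree. -/
theorem IsMergedContour.mk_dartWord_eq_one {X : Type*} (label : E → X) {v₀ : V} {S : Finset F}
    {D : Finset E} {L : List (E × Bool)} (h : G.IsMergedContour v₀ S D L) (d₀ : E × Bool)
    (h₀ : G.face d₀ ∈ S) (hL : ∀ d ∈ L, G.face (reverseDart d) ∈ S) :
    FreeGroup.mk (dartWord label L) = 1 := by
  classical
  have hmem : ∀ d, G.face d ∈ S := by
    refine G.mem_of_dual_closed (S : Set F) d₀ h₀ fun d hd => ?_
    by_cases hD : d.1 ∈ D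
    · exact h.face_mem (reverseDart d) hD
    · exact hL d ((h.mem_iff d).2 ⟨hd, hD⟩)
  have hS : S = Finset.univ := by
    refine Finset.eq_univ_of_forall fun f => ?_
    obtain ⟨d, rfl⟩ | ⟨hE, -⟩ := G.exists_dart f
    · exact hmem d
    · exact hE.elim d₀.1
  have hcard : Dᶜ.card + 1 = Fintype.card V := by
    have h1 := h.card
    have h2 := G.euler
    have h3 := Finset.card_add_card_compl D
    rw [hS, Finset.card_univ] at h1
    omega
  -- The merged contour visits every vertex without using deleted edges, so it must leave any proper
  -- vertex set containing `v₀`.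
  obtain ⟨φ, hφ⟩ := exists_potential (o := G.origin) Dᶜ hcard v₀ (by
    intro U hU hne
    obtain ⟨v, hv⟩ : ∃ v, v ∉ U := by
      by_contra! hall
      exact hne (Finset.eq_univ_of_forall hall)
    obtain ⟨d, rfl⟩ := G.exists_origin_eq d₀ v
    obtain ⟨A, B, rfl, hA⟩ := h.visits d (hmem d)
    obtain ⟨d', hd', hin, hout⟩ := hA.exists_exit (U := (U : Set V)) hU hv
    exact ⟨d', by simpa using ((h.mem_iff d').1 (by simp [hd'])).2, hin, hout⟩)
    (fun d => FreeGroup.mk [(label d.1, d.2)])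
    (fun d => by simp [reverseDart, FreeGroup.inv_mk, FreeGroup.invRev])
  have := mk_dartWord_of_potential (label := label) h.walk (φ := φ) fun d hd =>
    hφ d (by simpa using ((h.mem_iff d).1 hd).2)
  simpa using this

end PlaneGraph

/-! ### Extracting the relators from a diagram -/

namespace VanKampenDiagram

variable {X V E F : Type*} {R : Set (List (X × Bool))} [Fintype V] [Fintype E] [Fintype F]
  (Δ : VanKampenDiagram R V E F)

theorem contourWord_mem_cyclicShifts {d : E × Bool} (hd : Δ.face d ≠ Δ.outer) :
    dartWord Δ.label (Δ.contour d) ∈ cyclicShifts R := by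
  obtain ⟨r, hr, d', hd', h⟩ := Δ.cell_label _ hd
  have hrot : List.IsRotated (dartWord Δ.label (Δ.contour d)) (Δ.contourWord Δ.label d') :=
    (Δ.isRotated_contour hd'.symm).map _
  refine ⟨r, hr, ?_⟩
  rcases h with rfl | rfl
  · exact .inl hrot
  · right; simpa using hrot

/-- Going along the contour of the merged faces, one merges a further cell whenever one meets an
edge that separates it from them. -/
theorem exists_insertsInto_aux (n : ℕ) (v₀ : V) (S : Finset F) (hn : S.card + n = Fintype.card F)
    (hS : Δ.outer ∈ S) (D : Finset E) (P Q : List (E × Bool))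
    (h : Δ.IsMergedContour v₀ S D (P ++ Q)) (hP : ∀ d ∈ P, Δ.face (reverseDart d) ∈ S) :
    ∃ S' D' Q', Δ.outer ∈ S' ∧ Δ.IsMergedContour v₀ S' D' (P ++ Q') ∧
      (∀ d ∈ P ++ Q', Δ.face (reverseDart d) ∈ S') ∧
      InsertsInto (cyclicShifts R) (dartWord Δ.label Q') (FreeGroup.mk (dartWord Δ.label Q)) := by
  classical
  -- `n` counts the faces not yet merged and `P` is the part of the walk already examined. A merge
  -- may lengthen `Q` but lowers `n`, hence the inner induction on `Q`.
  induction n generalizing S D P Q with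
  | zero =>
    obtain rfl : S = Finset.univ := by rw [← Finset.card_eq_iff_eq_univ]; omega
    refine ⟨_, D, Q, hS, h, by simp, ?_⟩
    clear h
    induction Q with
    | nil => exact .nil
    | cons d Q ih => simpa [FreeGroup.mul_mk, dartWord] using ih.letter (Δ.label d.1, d.2)
  | succ n ihn =>
    induction Q generalizing P with
    | nil => exact ⟨S, D, [], hS, h, by simpa using hP, .nil⟩
    | cons d Q ih =>
      by_cases hd : Δ.face (reverseDart d) ∈ S
      · obtain ⟨S', D', Q', h1, h2, h3, h4⟩ := ih (P ++ [d]) (by simpa using h) (by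
          intro d' hd'
          rcases List.mem_append.1 hd' with hd' | hd'
          · exact hP d' hd'
          · rwa [List.mem_singleton.1 hd'])
        refine ⟨S', D', d :: Q', h1, by simpa using h2, by simpa using h3, ?_⟩
        simpa [FreeGroup.mul_mk, dartWord] using h4.letter (Δ.label d.1, d.2)
      · obtain ⟨c, hc⟩ := Δ.exists_contour_eq_cons (reverseDart d)
        obtain ⟨S', D', Q', h1, h2, h3, h4⟩ := ihn (insert (Δ.face (reverseDart d)) S)
          (by rw [Finset.card_insert_of_notMem hd]; omega) (by simp [hS]) (insert d.1 D) P
          (c ++ Q) (h.merge hd hc) (fun d' hd' => Finset.mem_insert_of_mem (hP d' hd'))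
        refine ⟨S', D', Q', h1, h2, h3, ?_⟩
        have hr := Δ.contourWord_mem_cyclicShifts (d := reverseDart d) (fun h => hd (h ▸ hS))
        rw [hc] at hr
        -- The cell reads d⁻¹ c; its shift c d⁻¹ has inverse d c⁻¹, the word to be inserted before
        -- `c`.
        have hr' := invRev_mem_cyclicShifts (cyclicShifts_of_isRotated
          (a := dartWord Δ.label c ++ [(Δ.label d.1, !d.2)])
          (List.isRotated_append (l := dartWord Δ.label c) (l' := [_])) hr)
        have e : FreeGroup.mk (dartWord Δ.label (d :: Q)) =
            FreeGroup.mk (FreeGroup.invRev (dartWord Δ.label c ++ [(Δ.label d.1, !d.2)])) *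
              FreeGroup.mk (dartWord Δ.label (c ++ Q)) := by
          rw [← FreeGroup.inv_mk, ← FreeGroup.mul_mk, mul_inv_rev, FreeGroup.inv_mk]
          simp only [dartWord, List.map_append, List.map_cons, ← FreeGroup.mul_mk]
          rw [mul_assoc, inv_mul_cancel_left]
          simp [FreeGroup.invRev, FreeGroup.mul_mk]
        rw [e]
        exact h4.insert hr'

theorem exists_insertsInto {W : List (X × Bool)} (hW : Δ.IsBoundaryLabel W) :
    ∃ p, InsertsInto (cyclicShifts R) p (FreeGroup.mk W) ∧ FreeGroup.mk p = 1 ∧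
      p.length ≤ 2 * Fintype.card E := by
  have key : ∀ d, Δ.face d = Δ.outer → ∃ p, InsertsInto (cyclicShifts R) p
      (FreeGroup.mk (Δ.contourWord Δ.label d)) ∧ FreeGroup.mk p = 1 ∧
      p.length ≤ 2 * Fintype.card E := by
    intro d hd
    have hcard : 1 ≤ Fintype.card F := Fintype.card_pos_iff.2 ⟨Δ.outer⟩
    obtain ⟨S, D, Q, h1, h2, h3, h4⟩ := Δ.exists_insertsInto_aux (Fintype.card F - 1)
      (Δ.origin d) {Δ.face d} (by simp; omega) (by simp [hd]) ∅ [] (Δ.contour d)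
      (PlaneGraph.isMergedContour_contour d) (by simp)
    refine ⟨_, h4, h2.mk_dartWord_eq_one Δ.label d (hd ▸ h1) h3, ?_⟩
    -- There are 2e darts in all.
    have := List.Nodup.length_le_card h2.nodup
    simpa [dartWord, mul_comm] using this
  rcases hW with ⟨d, hd, rfl | rfl⟩ | ⟨-, rfl⟩
  · exact key d hd
  · obtain ⟨p, h1, h2, h3⟩ := key d hd
    refine ⟨FreeGroup.invRev p, ?_, ?_, by simpa using h3⟩
    · rw [← FreeGroup.inv_mk]
      exact h1.inv fun _ => invRev_mem_cyclicShifts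
    · rw [← FreeGroup.inv_mk, h2, inv_one]
  · exact ⟨[], .nil, rfl, by simp⟩

end VanKampenDiagram

theorem mainTheorem1 {X : Type*} {R : Set (List (X × Bool))}
    {V E F : Type*} [Fintype V] [Fintype E] [Fintype F]
    (Δ : VanKampenDiagram R V E F) (W : List (X × Bool)) (hW : Δ.IsBoundaryLabel W) :
    (∃ (m : ℕ) (u : Fin (m + 1) → List (X × Bool)) (r : Fin m → List (X × Bool)),
      FreeGroup.mk W =
          FreeGroup.mk
            ((List.ofFn fun i : Fin m => u i.castSucc ++ r i).flatten ++ u (Fin.last m)) ∧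
        (∀ i, ∃ s ∈ R, List.IsRotated (r i) s ∨ List.IsRotated (r i) (FreeGroup.invRev s)) ∧
        FreeGroup.mk (List.ofFn u).flatten = 1 ∧
        ∑ i, (u i).length ≤ 4 * Fintype.card E) ∧
      FreeGroup.mk W ∈ Subgroup.normalClosure (FreeGroup.mk '' R) ∧
      PresentedGroup.mk (FreeGroup.mk '' R) (FreeGroup.mk W) = 1 := by
  obtain ⟨p, hp, hp1, hlen⟩ := Δ.exists_insertsInto hW
  have hone : PresentedGroup.mk (FreeGroup.mk '' R) (FreeGroup.mk W) = 1 := by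
    rw [hp.map_eq (PresentedGroup.mk (FreeGroup.mk '' R)) fun r hr =>
      (QuotientGroup.eq_one_iff _).2 (mk_mem_normalClosure_of_mem_cyclicShifts hr), hp1, map_one]
  refine ⟨?_, (QuotientGroup.eq_one_iff _).1 hone, hone⟩
  obtain ⟨m, u, r, hg, hr, rfl⟩ := hp.exists_fin
  refine ⟨m, u, r, hg, hr, hp1, ?_⟩
  rw [List.length_flatten, List.map_ofFn, List.sum_ofFn] at hlen
  simp only [Function.comp_apply] at hlen
  omega
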